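/- For a homogeneous cubic polynomial $f\in\mathbb{R}[x,y,z]$ let $\Gamma_f=\{[X]\in\mathbb{RP}^2 : f(X)=0\}$, and let the Hesse derivative of $\Gamma_f$ be the curve $\mathcal{H}\Gamma_f:=\Gamma_{\det H_f}$, where $H_f$ is the matrix of second partial derivatives of $f$; iterates $\mathcal{H}^n$ are formed by iterating $f\mapsto\det H_f$. For $c\in\mathbb{R}$ let $\Gamma_c$ be the curve given by $x^3+y^3+z^3+c\,xyz=0$ and let $\Gamma_\infty$ be the curve given by $xyz=0$. For $e\in\{-3,\infty\}$, a Hesse chain of length $n$ ending in $\Gamma_e$ is an orbit $\Gamma_{c},\mathcal{H}\Gamma_{c},\dots,\mathcal{H}^n\Gamma_{c}$ with $c\in\mathbb{R}\cup\{\infty\}$, $\mathcal{H}^n\Gamma_{c}=\Gamma_e$, and $\mathcal{H}^m\Gamma_{c}\neq\Gamma_e$ for all $0\le m<n$. Then for every integer $r\ge 1$: 1. there are exactly $3^{r-1}$ Hesse chains of length $2r$ ending in $\Gamma_{-3}$, and exactly $3^{r-1}$ Hesse chains of length $2r-1$ ending in $\Gamma_{-3}$; 2. there are exactly $3^{r-1}$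 Hesse chains of length $2r$ ending in $\Gamma_\infty$, and exactly $3^{r-1}$ Hesse chains of length $2r-1$ ending in $\Gamma_\infty$. -/

import Mathlib

open MvPolynomial in
/-- The Hesse matrix of a polynomial in three variables: the matrix of its second partial
derivatives. -/
noncomputable def hesseMatrix (f : MvPolynomial (Fin 3) ℝ) :
    Matrix (Fin 3) (Fin 3) (MvPolynomial (Fin 3) ℝ) :=
  Matrix.of fun i j => pderiv i (pderiv j f)

/-- The polynomial that defines the Hesse derivative of the curve defined by `f`. -/
noncomputable def hesseDet (f : MvPolynomial (Fin 3) ℝ) : MvPolynomial (Fin 3) ℝ :=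
  (hesseMatrix f).det

/-- The curve in the real projective plane defined by a homogeneous polynomial in three
variables. -/
def projCurve (f : MvPolynomial (Fin 3) ℝ) : Set (Projectivization ℝ (Fin 3 → ℝ)) :=
  {p | MvPolynomial.eval p.rep f = 0}

/-- For a cubic form, membership in the curve may be tested on any representative of a point. -/
theorem mk_mem_projCurve {f : MvPolynomial (Fin 3) ℝ} (hf : f.IsHomogeneous 3)
    (v : Fin 3 → ℝ) (hv : v ≠ 0) :
    Projectivization.mk ℝ v hv ∈ projCurve f ↔ MvPolynomial.eval v f = 0 := by
  obtain ⟨a, ha⟩ := Projectivization.exists_smul_eq_mk_rep ℝ v hv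
  have key : MvPolynomial.eval ((a : ℝ) • v) f = (a : ℝ) ^ 3 * MvPolynomial.eval v f := by
    rw [MvPolynomial.eval_eq, MvPolynomial.eval_eq, Finset.mul_sum]
    refine Finset.sum_congr rfl fun d hd => ?_
    have hdeg : ∑ i ∈ d.support, d i = 3 :=
      (hf.degree_eq_sum_deg_support hd).symm
    simp only [Pi.smul_apply, smul_eq_mul, mul_pow, Finset.prod_mul_distrib]
    rw [Finset.prod_pow_eq_pow_sum, hdeg]
    ring
  have ha' : (a : ℝ) • v = (Projectivization.mk ℝ v hv).rep := ha
  simp only [projCurve, Set.mem_ofPred_eq]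
  rw [← ha', key]
  simp

open MvPolynomial in
/-- The cubic forms in Hesse form, with `c` a real number or `∞`:
`x³ + y³ + z³ + c x y z` for real `c`, and `x y z` for `c = ∞`. -/
noncomputable def hesseForm : OnePoint ℝ → MvPolynomial (Fin 3) ℝ
  | some c => X 0 ^ 3 + X 1 ^ 3 + X 2 ^ 3 + C c * (X 0 * X 1 * X 2)
  | none => X 0 * X 1 * X 2

/-- The curve `Γ_c` in the real projective plane, with `c` a real number or `∞`. -/
noncomputable def hesseCurve (c : OnePoint ℝ) : Set (Projectivization ℝ (Fin 3 → ℝ)) :=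
  projCurve (hesseForm c)

/-- The `n`-th iterated Hesse derivative of the curve `Γ_c`. -/
noncomputable def iterHesseDerivative (n : ℕ) (c : OnePoint ℝ) :
    Set (Projectivization ℝ (Fin 3 → ℝ)) :=
  projCurve (hesseDet^[n] (hesseForm c))

/-- The set of Hesse chains of length `n` ending in `Γ_e`: the orbits `Γ 0, …, Γ n` of the
iterated Hesse derivative which start at a curve in Hesse form and reach `Γ_e` for the first time
at step `n`. -/
def hesseChains (e : OnePoint ℝ) (n : ℕ) :
    Set (Fin (n + 1) → Set (Projectivization ℝ (Fin 3 → ℝ))) :=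
  {Γ | (∃ c : OnePoint ℝ, ∀ i, Γ i = iterHesseDerivative i c) ∧
    Γ (Fin.last n) = hesseCurve e ∧ ∀ i, i < Fin.last n → Γ i ≠ hesseCurve e}

/-! Up to a nonzero scalar, the Hessian determinant of a cubic in Hesse form is again in Hesse form,
so the Hesse derivative acts on parameters by `hesseStep`. Since `c` is determined by the real
points of its curve, counting chains means counting iterated preimages. Each end `e` is fixed and
has one other preimage `p` (6 for -3, 0 for ∞), so chains of length `n + 1` correspond to `n`-fold
preimages of `p`.

The preimages of a real `d` are the real roots of `c ^ 3 + 3 * d * c ^ 2 + 108`: a single one, below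
-3, if `d > -3`; three, all above -3, if `d < -3`. As 6 and 0 exceed -3, backward steps multiply the
count by 1 and 3 alternately. -/

open MvPolynomial in
theorem hesseForm_isHomogeneous (c : OnePoint ℝ) : (hesseForm c).IsHomogeneous 3 := by
  have hX (i : Fin 3) : (X i ^ 3 : MvPolynomial (Fin 3) ℝ).IsHomogeneous 3 := by
    simpa using (isHomogeneous_X ℝ i).pow 3
  have hP : (X 0 * X 1 * X 2 : MvPolynomial (Fin 3) ℝ).IsHomogeneous 3 :=
    ((isHomogeneous_X ℝ 0).mul (isHomogeneous_X ℝ 1)).mul (isHomogeneous_X ℝ 2)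
  cases c with
  | infty => exact hP
  | coe c => exact (((hX 0).add (hX 1)).add (hX 2)).add (by simpa using hP.C_mul c)

open MvPolynomial in
theorem eval_hesseForm_coe (c : ℝ) (v : Fin 3 → ℝ) :
    eval v (hesseForm (c : OnePoint ℝ)) =
      v 0 ^ 3 + v 1 ^ 3 + v 2 ^ 3 + c * (v 0 * v 1 * v 2) := by
  change eval v (X 0 ^ 3 + X 1 ^ 3 + X 2 ^ 3 + C c * (X 0 * X 1 * X 2)) = _
  simp

open MvPolynomial in
theorem eval_hesseForm_infty (v : Fin 3 → ℝ) :
    eval v (hesseForm OnePoint.infty) = v 0 * v 1 * v 2 := by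
  change eval v (X 0 * X 1 * X 2) = _
  simp

/-! ### Recovering the parameter from the real curve -/

theorem exists_root_depressed_cubic (c : ℝ) : ∃ z : ℝ, z ^ 3 + c * z + 2 = 0 := by
  have hcont : ContinuousOn (fun z : ℝ => z ^ 3 + c * z + 2) (Set.Icc (-(|c| + 2)) 0) := by
    fun_prop
  have hle : -(|c| + 2) ≤ (0 : ℝ) := by linarith [abs_nonneg c]
  have hlow : (-(|c| + 2)) ^ 3 + c * (-(|c| + 2)) + 2 ≤ 0 := by
    have h1 := abs_nonneg c
    have h2 := neg_abs_le c
    nlinarith [mul_nonneg h1 h1, mul_nonneg h1 (mul_nonneg h1 h1),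
      mul_nonneg h1 (by linarith : 0 ≤ c + |c|)]
  obtain ⟨z, -, hz⟩ := intermediate_value_Icc hle hcont
    (show (0 : ℝ) ∈ Set.Icc _ _ from ⟨hlow, by norm_num⟩)
  exact ⟨z, hz⟩

theorem hesseCurve_injective : Function.Injective hesseCurve := by
  have hmem {c d : OnePoint ℝ} (h : hesseCurve c = hesseCurve d) (v : Fin 3 → ℝ) (hv : v ≠ 0) :
      MvPolynomial.eval v (hesseForm c) = 0 ↔ MvPolynomial.eval v (hesseForm d) = 0 := by
    rw [← mk_mem_projCurve (hesseForm_isHomogeneous c) v hv,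
      ← mk_mem_projCurve (hesseForm_isHomogeneous d) v hv]
    exact Set.ext_iff.1 h _
  have hpt (z : ℝ) : (![1, 1, z] : Fin 3 → ℝ) ≠ 0 := fun h => by simpa using congrFun h 0
  have hne (c : ℝ) : hesseCurve (c : OnePoint ℝ) ≠ hesseCurve OnePoint.infty := by
    intro h
    have := hmem h ![1, 0, 0] (fun h => by simpa using congrFun h 0)
    rw [eval_hesseForm_coe, eval_hesseForm_infty] at this
    simp at this
  intro c d h
  cases c with
  | infty =>
    cases d with
    | infty => rfl
    | coe d => exact absurd h.symm (hne d)
  | coe c =>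
    cases d with
    | infty => exact absurd h (hne c)
    | coe d =>
      -- A real point with `xyz ≠ 0` determines the parameter; `[1 : 1 : z]` is such a point.
      obtain ⟨z, hz⟩ := exists_root_depressed_cubic c
      have h2 := hmem h ![1, 1, z] (hpt z)
      simp only [eval_hesseForm_coe, Matrix.cons_val] at h2
      have hd := h2.1 (by linarith)
      have hz0 : z ≠ 0 := by
        rintro rfl
        norm_num at hz
      have : (c - d) * z = 0 := by linarith
      rw [sub_eq_zero.1 ((mul_eq_zero.1 this).resolve_right hz0)]

/-! ### The induced dynamics on parameters -/

theorem projCurve_C_mul {k : ℝ} (hk : k ≠ 0) (f : MvPolynomial (Fin 3) ℝ) :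
    projCurve (MvPolynomial.C k * f) = projCurve f := by
  ext p
  simp [projCurve, hk]

/-- The action of the Hesse derivative on the parameter of a cubic in Hesse form. -/
noncomputable def hesseStep : OnePoint ℝ → OnePoint ℝ
  | some c => if c = 0 then OnePoint.infty else ((-(c ^ 3 + 108) / (3 * c ^ 2) : ℝ) : OnePoint ℝ)
  | none => OnePoint.infty

theorem hesseStep_infty : hesseStep OnePoint.infty = OnePoint.infty := rfl

theorem hesseStep_zero : hesseStep ((0 : ℝ) : OnePoint ℝ) = OnePoint.infty := if_pos rfl

theorem hesseStep_coe {c : ℝ} (hc : c ≠ 0) :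
    hesseStep (c : OnePoint ℝ) = ((-(c ^ 3 + 108) / (3 * c ^ 2) : ℝ) : OnePoint ℝ) := if_neg hc

theorem hesseStep_eq_coe_iff (x : OnePoint ℝ) (d : ℝ) :
    hesseStep x = d ↔ ∃ c : ℝ, x = c ∧ c ^ 3 + 3 * d * c ^ 2 + 108 = 0 := by
  cases x with
  | infty => simp [hesseStep_infty]
  | coe c =>
    by_cases hc : c = 0
    · subst hc
      simp [hesseStep_zero]
    · rw [hesseStep_coe hc]
      simp only [OnePoint.coe_eq_coe, exists_eq_left']
      rw [div_eq_iff (by positivity)]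
      constructor <;> intro h <;> linarith

theorem hesseStep_eq_infty_iff (x : OnePoint ℝ) :
    hesseStep x = OnePoint.infty ↔ x = OnePoint.infty ∨ x = ((0 : ℝ) : OnePoint ℝ) := by
  cases x with
  | infty => simp [hesseStep_infty]
  | coe c =>
    by_cases hc : c = 0
    · subst hc
      simp [hesseStep_zero]
    · simp [hesseStep_coe hc, hc]

theorem hesseStep_eq_neg_three_iff (x : OnePoint ℝ) :
    hesseStep x = ((-3 : ℝ) : OnePoint ℝ) ↔
      x = ((-3 : ℝ) : OnePoint ℝ) ∨ x = ((6 : ℝ) : OnePoint ℝ) := by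
  rw [hesseStep_eq_coe_iff]
  constructor
  · rintro ⟨c, rfl, hc⟩
    have : (c + 3) * (c - 6) ^ 2 = 0 := by linarith
    rcases mul_eq_zero.1 this with h | h
    · left
      rw [eq_neg_of_add_eq_zero_left h]
    · right
      rw [sub_eq_zero.1 (pow_eq_zero_iff two_ne_zero |>.1 h)]
  · rintro (rfl | rfl)
    · exact ⟨-3, rfl, by norm_num⟩
    · exact ⟨6, rfl, by norm_num⟩

theorem hesseDet_C_mul (k : ℝ) (f : MvPolynomial (Fin 3) ℝ) :
    hesseDet (MvPolynomial.C k * f) = MvPolynomial.C (k ^ 3) * hesseDet f := by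
  have : hesseMatrix (MvPolynomial.C k * f) =
      (MvPolynomial.C k : MvPolynomial (Fin 3) ℝ) • hesseMatrix f := by
    ext1 i j
    simp [hesseMatrix]
  simp [hesseDet, this]

open MvPolynomial in
theorem hesseDet_hesseForm_coe (c : ℝ) :
    hesseDet (hesseForm (c : OnePoint ℝ)) =
      C (-6 * c ^ 2) * (X 0 ^ 3 + X 1 ^ 3 + X 2 ^ 3) + C (216 + 2 * c ^ 3) * (X 0 * X 1 * X 2) := by
  change hesseDet (X 0 ^ 3 + X 1 ^ 3 + X 2 ^ 3 + C c * (X 0 * X 1 * X 2)) = _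
  have h3 (i : Fin 3) : pderiv i (3 : MvPolynomial (Fin 3) ℝ) = 0 := by
    simpa using (pderiv (R := ℝ) i).map_natCast 3
  simp [hesseDet, hesseMatrix, Matrix.det_fin_three, pderiv_X, Pi.single_apply,
    Derivation.leibniz, h3]
  have h6 : (C 6 : MvPolynomial (Fin 3) ℝ) = 6 := map_ofNat _ _
  have h2 : (C 2 : MvPolynomial (Fin 3) ℝ) = 2 := map_ofNat _ _
  have h216 : (C 216 : MvPolynomial (Fin 3) ℝ) = 216 := map_ofNat _ _
  simp only [h6, h2, h216]
  ring

open MvPolynomial in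
theorem hesseDet_hesseForm_infty :
    hesseDet (hesseForm OnePoint.infty) = C 2 * hesseForm OnePoint.infty := by
  change hesseDet (X 0 * X 1 * X 2) = C 2 * (X 0 * X 1 * X 2)
  simp [hesseDet, hesseMatrix, Matrix.det_fin_three, pderiv_X, Pi.single_apply,
    Derivation.leibniz]
  have h2 : (C 2 : MvPolynomial (Fin 3) ℝ) = 2 := map_ofNat _ _
  simp only [h2]
  ring

theorem exists_hesseDet_hesseForm (c : OnePoint ℝ) :
    ∃ k : ℝ, k ≠ 0 ∧ hesseDet (hesseForm c) = MvPolynomial.C k * hesseForm (hesseStep c) := by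
  cases c with
  | infty => exact ⟨2, two_ne_zero, hesseDet_hesseForm_infty⟩
  | coe c =>
    rw [hesseDet_hesseForm_coe]
    by_cases hc : c = 0
    · subst hc
      refine ⟨216, by norm_num, ?_⟩
      rw [hesseStep_zero]
      simp [hesseForm]
    · refine ⟨-6 * c ^ 2, by simp [hc], ?_⟩
      rw [hesseStep_coe hc]
      have h : 216 + 2 * c ^ 3 = -6 * c ^ 2 * (-(c ^ 3 + 108) / (3 * c ^ 2)) := by
        field_simp
        ring
      rw [h, map_mul MvPolynomial.C (-6 * c ^ 2) (_ / _)]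
      change _ = _ * (_ + _)
      ring

theorem exists_iterate_hesseDet (n : ℕ) (c : OnePoint ℝ) :
    ∃ k : ℝ, k ≠ 0 ∧
      hesseDet^[n] (hesseForm c) = MvPolynomial.C k * hesseForm (hesseStep^[n] c) := by
  induction n with
  | zero => exact ⟨1, one_ne_zero, by simp⟩
  | succ n ih =>
    obtain ⟨k, hk, h⟩ := ih
    obtain ⟨l, hl, h'⟩ := exists_hesseDet_hesseForm (hesseStep^[n] c)
    refine ⟨k ^ 3 * l, mul_ne_zero (pow_ne_zero 3 hk) hl, ?_⟩
    rw [Function.iterate_succ_apply', h, hesseDet_C_mul, h', Function.iterate_succ_apply',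
      map_mul, mul_assoc]

theorem iterHesseDerivative_eq (n : ℕ) (c : OnePoint ℝ) :
    iterHesseDerivative n c = hesseCurve (hesseStep^[n] c) := by
  obtain ⟨k, hk, h⟩ := exists_iterate_hesseDet n c
  rw [iterHesseDerivative, h, projCurve_C_mul hk, hesseCurve]

/-- Hesse chains ending in a fixed curve `Γ_e` whose only other preimage is `Γ_p` correspond to
the iterated preimages of `p`. -/
theorem encard_hesseChains {e p : OnePoint ℝ} (hpe : p ≠ e)
    (hfib : ∀ x, hesseStep x = e ↔ x = e ∨ x = p) (n : ℕ) :
    (hesseChains e (n + 1)).encard = (hesseStep^[n] ⁻¹' {p}).encard := by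
  have hfix : hesseStep e = e := (hfib e).2 (Or.inl rfl)
  let orbit (c : OnePoint ℝ) (i : Fin (n + 1 + 1)) := iterHesseDerivative i c
  have hinj : Function.Injective orbit := fun c d h => by
    have := congrFun h 0
    simp only [orbit, iterHesseDerivative_eq] at this
    exact hesseCurve_injective this
  have himage : hesseChains e (n + 1) = orbit '' (hesseStep^[n] ⁻¹' {p}) := by
    ext Γ
    constructor
    · rintro ⟨⟨c, hc⟩, hlast, hbefore⟩
      refine ⟨c, ?_, (funext hc).symm⟩
      rw [hc, iterHesseDerivative_eq] at hlast
      have hlast := hesseCurve_injective hlast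
      rw [Fin.val_last, Function.iterate_succ_apply', hfib] at hlast
      refine hlast.resolve_left fun h => hbefore (Fin.last n).castSucc (Fin.castSucc_lt_last _) ?_
      rw [hc, iterHesseDerivative_eq]
      exact congrArg hesseCurve h
    · rintro ⟨c, hc, rfl⟩
      have hc : hesseStep^[n] c = p := hc
      refine ⟨⟨c, fun _ => rfl⟩, ?_, fun i hi h => hpe ?_⟩
      · simp only [orbit, iterHesseDerivative_eq, Fin.val_last]
        rw [Function.iterate_succ_apply', hc, (hfib p).2 (Or.inr rfl)]
      · simp only [orbit, iterHesseDerivative_eq] at h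
        have h := hesseCurve_injective h
        have hi : (i : ℕ) ≤ n := Nat.lt_succ_iff.1 hi
        -- Once at the fixed point `e`, the orbit stays there, so its `n`-th term `p` would be `e`.
        rw [← hc, ← Nat.sub_add_cancel hi, Function.iterate_add_apply, h,
          Function.iterate_fixed hfix]
  rw [himage, hinj.encard_image]

/-! ### Real preimages of a parameter -/

/-- The cubic equals `(c + 3) * (c - 6) ^ 2 + 3 * (d + 3) * c ^ 2`, and for `c ≤ -3` the first term
is nonpositive and the second negative. -/
theorem neg_three_lt_of_cubic_eq_zero {c d : ℝ} (hd : d < -3)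
    (h : c ^ 3 + 3 * d * c ^ 2 + 108 = 0) : -3 < c := by
  by_contra! hc
  nlinarith [mul_nonneg (by linarith : 0 ≤ -(c + 3)) (sq_nonneg (c - 6)),
    mul_pos (by linarith : 0 < -(d + 3)) (pow_pos (by linarith : 0 < -c) 2)]

theorem lt_neg_three_of_cubic_eq_zero {c d : ℝ} (hd : -3 < d)
    (h : c ^ 3 + 3 * d * c ^ 2 + 108 = 0) : c < -3 := by
  have hc0 : c ≠ 0 := by
    rintro rfl
    norm_num at h
  by_contra! hc
  nlinarith [mul_nonneg (by linarith : 0 ≤ c + 3) (sq_nonneg (c - 6)),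
    mul_pos (by linarith : 0 < d + 3) (by positivity : 0 < c ^ 2)]

theorem exists_cubic_fibre_of_neg_three_lt {d : ℝ} (hd : -3 < d) :
    ∃ a : ℝ, ∀ c : ℝ, c ^ 3 + 3 * d * c ^ 2 + 108 = 0 ↔ c = a := by
  have hcont : ContinuousOn (fun c : ℝ => c ^ 3 + 3 * d * c ^ 2 + 108)
      (Set.Icc (-(3 * |d| + 6)) (-3)) := by fun_prop
  have hlow : (-(3 * |d| + 6)) ^ 3 + 3 * d * (-(3 * |d| + 6)) ^ 2 + 108 ≤ 0 := by
    have h1 := abs_nonneg d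
    have h2 := le_abs_self d
    have h3 : 36 ≤ (3 * |d| + 6) ^ 2 := by nlinarith
    nlinarith [mul_nonneg (by linarith : 0 ≤ |d| - d) (sq_nonneg (3 * |d| + 6))]
  obtain ⟨a, -, ha⟩ := intermediate_value_Icc (by linarith [abs_nonneg d]) hcont
    (show (0 : ℝ) ∈ Set.Icc _ _ from ⟨hlow, by linarith⟩)
  refine ⟨a, fun c => ⟨fun hc => ?_, fun hc => hc ▸ ha⟩⟩
  have ha : a ^ 3 + 3 * d * a ^ 2 + 108 = 0 := ha
  have ha3 := lt_neg_three_of_cubic_eq_zero hd ha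
  have hc3 := lt_neg_three_of_cubic_eq_zero hd hc
  -- Eliminating `d` between the two equations; the cofactor of `c - a` is positive because both
  -- roots are negative.
  have hprod : (c - a) * (a ^ 2 * c ^ 2 - 108 * (a + c)) = 0 := by
    linear_combination a ^ 2 * hc - c ^ 2 * ha
  have hpos : 0 < a ^ 2 * c ^ 2 - 108 * (a + c) := by
    nlinarith [mul_nonneg (sq_nonneg a) (sq_nonneg c)]
  exact sub_eq_zero.1 ((mul_eq_zero.1 hprod).resolve_right hpos.ne')

theorem exists_cubic_fibre_of_lt_neg_three {d : ℝ} (hd : d < -3) :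
    ∃ a b e : ℝ, a ≠ b ∧ a ≠ e ∧ b ≠ e ∧
      ∀ c : ℝ, c ^ 3 + 3 * d * c ^ 2 + 108 = 0 ↔ c = a ∨ c = b ∨ c = e := by
  have hcont (s : Set ℝ) : ContinuousOn (fun c : ℝ => c ^ 3 + 3 * d * c ^ 2 + 108) s := by
    fun_prop
  -- At -3, 0, 6 and `-3 * d` the cubic takes the values `27 * (d + 3)`, 108, `108 * (d + 3)` and
  -- 108, of alternating sign.
  obtain ⟨a, ha', ha⟩ := intermediate_value_Ioo (by norm_num : (-3 : ℝ) ≤ 0) (hcont _)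
    (show (0 : ℝ) ∈ Set.Ioo _ _ from ⟨by linarith, by norm_num⟩)
  obtain ⟨b, hb', hb⟩ := intermediate_value_Ioo' (by norm_num : (0 : ℝ) ≤ 6) (hcont _)
    (show (0 : ℝ) ∈ Set.Ioo _ _ from ⟨by linarith, by norm_num⟩)
  obtain ⟨e, he', he⟩ := intermediate_value_Ioo (by linarith : (6 : ℝ) ≤ -3 * d) (hcont _)
    (show (0 : ℝ) ∈ Set.Ioo _ _ from ⟨by linarith, by ring_nf; norm_num⟩)
  have hab : a ≠ b := (ha'.2.trans hb'.1).ne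
  have hbe : b ≠ e := (hb'.2.trans he'.1).ne
  have hae : a ≠ e := (ha'.2.trans (by linarith [he'.1])).ne
  refine ⟨a, b, e, hab, hae, hbe, fun c => ⟨fun hc => ?_, ?_⟩⟩
  · by_contra! hne
    obtain ⟨hca, hcb, hce⟩ := hne
    -- Two rounds of divided differences show that three distinct roots sum to `-3 * d`, so `a` and
    -- `b` determine the third.
    have hsum {x : ℝ} (hx : x ^ 3 + 3 * d * x ^ 2 + 108 = 0) (hxa : x - a ≠ 0) :
        x ^ 2 + x * a + a ^ 2 + 3 * d * (x + a) = 0 := by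
      refine (mul_eq_zero.1 (?_ : (x - a) * _ = 0)).resolve_left hxa
      linear_combination hx - ha
    have h1 := hsum hb (sub_ne_zero.2 hab.symm)
    have h2 := hsum he (sub_ne_zero.2 hae.symm)
    have h3 := hsum hc (sub_ne_zero.2 hca)
    have h4 : b + e + a + 3 * d = 0 := by
      refine (mul_eq_zero.1 (?_ : (b - e) * _ = 0)).resolve_left (sub_ne_zero.2 hbe)
      linear_combination h1 - h2
    have h5 : b + c + a + 3 * d = 0 := by
      refine (mul_eq_zero.1 (?_ : (b - c) * _ = 0)).resolve_left (sub_ne_zero.2 hcb.symm)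
      linear_combination h1 - h3
    exact hce (by linarith)
  · rintro (rfl | rfl | rfl) <;> assumption

theorem encard_preimage_hesseStep_of_neg_three_lt {d : ℝ} (hd : -3 < d) :
    (hesseStep ⁻¹' {(d : OnePoint ℝ)}).encard = 1 := by
  obtain ⟨a, h⟩ := exists_cubic_fibre_of_neg_three_lt hd
  rw [Set.encard_eq_one]
  refine ⟨a, Set.ext fun x => ?_⟩
  simp [hesseStep_eq_coe_iff, h]

theorem encard_preimage_hesseStep_of_lt_neg_three {d : ℝ} (hd : d < -3) :
    (hesseStep ⁻¹' {(d : OnePoint ℝ)}).encard = 3 := by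
  obtain ⟨a, b, e, hab, hae, hbe, h⟩ := exists_cubic_fibre_of_lt_neg_three hd
  rw [Set.encard_eq_three]
  refine ⟨a, b, e, by simpa, by simpa, by simpa, Set.ext fun x => ?_⟩
  simp only [Set.mem_preimage, Set.mem_singleton_iff, hesseStep_eq_coe_iff, h,
    Set.mem_insert_iff]
  constructor
  · rintro ⟨c, rfl, rfl | rfl | rfl⟩ <;> simp
  · rintro (rfl | rfl | rfl) <;> simp

/-! ### Counting iterated preimages -/

theorem Set.Finite.encard_preimage_of_forall_fibre {α β : Type*} (f : α → β) {m : ℕ∞} {s : Set β}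
    (hs : s.Finite) (h : ∀ b ∈ s, (f ⁻¹' {b}).encard = m) :
    (f ⁻¹' s).encard = s.encard * m := by
  induction s, hs using Set.Finite.induction_on with
  | empty => simp
  | @insert a s ha hs ih =>
    have hdisj : Disjoint (f ⁻¹' {a}) (f ⁻¹' s) :=
      (Set.disjoint_singleton_left.2 ha).preimage f
    rw [Set.insert_eq, Set.preimage_union, Set.encard_union_eq hdisj,
      h a (Set.mem_insert a s), ih fun b hb => h b (Set.mem_insert_of_mem a hb), ← Set.insert_eq,
      Set.encard_insert_of_notMem ha, add_mul, one_mul, add_comm]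

theorem preimage_hesseStep_of_neg_three_lt {s : Set (OnePoint ℝ)} (hfin : s.Finite)
    (h : ∀ x ∈ s, ∃ c : ℝ, x = c ∧ -3 < c) :
    (hesseStep ⁻¹' s).encard = s.encard ∧ ∀ x ∈ hesseStep ⁻¹' s, ∃ c : ℝ, x = c ∧ c < -3 := by
  constructor
  · rw [hfin.encard_preimage_of_forall_fibre hesseStep (m := 1), mul_one]
    intro b hb
    obtain ⟨c, rfl, hc⟩ := h b hb
    exact encard_preimage_hesseStep_of_neg_three_lt hc
  · intro x hx
    obtain ⟨d, hd, hd3⟩ := h _ hx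
    obtain ⟨c, rfl, hc⟩ := (hesseStep_eq_coe_iff x d).1 hd
    exact ⟨c, rfl, lt_neg_three_of_cubic_eq_zero hd3 hc⟩

theorem preimage_hesseStep_of_lt_neg_three {s : Set (OnePoint ℝ)} (hfin : s.Finite)
    (h : ∀ x ∈ s, ∃ c : ℝ, x = c ∧ c < -3) :
    (hesseStep ⁻¹' s).encard = s.encard * 3 ∧
      ∀ x ∈ hesseStep ⁻¹' s, ∃ c : ℝ, x = c ∧ -3 < c := by
  constructor
  · refine hfin.encard_preimage_of_forall_fibre hesseStep fun b hb => ?_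
    obtain ⟨c, rfl, hc⟩ := h b hb
    exact encard_preimage_hesseStep_of_lt_neg_three hc
  · intro x hx
    obtain ⟨d, hd, hd3⟩ := h _ hx
    obtain ⟨c, rfl, hc⟩ := (hesseStep_eq_coe_iff x d).1 hd
    exact ⟨c, rfl, neg_three_lt_of_cubic_eq_zero hd3 hc⟩

theorem encard_preimage_iterate_hesseStep {p : ℝ} (hp : -3 < p) (k : ℕ) :
    (hesseStep^[2 * k] ⁻¹' {(p : OnePoint ℝ)}).encard = 3 ^ k ∧
      (hesseStep^[2 * k + 1] ⁻¹' {(p : OnePoint ℝ)}).encard = 3 ^ k := by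
  have hpre (n : ℕ) : hesseStep^[n + 1] ⁻¹' {(p : OnePoint ℝ)} =
      hesseStep ⁻¹' (hesseStep^[n] ⁻¹' {(p : OnePoint ℝ)}) := rfl
  have hfin {s : Set (OnePoint ℝ)} {k : ℕ} (h : s.encard = 3 ^ k) : s.Finite :=
    Set.finite_of_encard_le_coe (k := 3 ^ k) (by rw [h]; simp)
  have heven : (hesseStep^[2 * k] ⁻¹' {(p : OnePoint ℝ)}).encard = 3 ^ k ∧
      ∀ x ∈ hesseStep^[2 * k] ⁻¹' {(p : OnePoint ℝ)}, ∃ c : ℝ, x = c ∧ -3 < c := by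
    induction k with
    | zero => exact ⟨by simp, fun x hx => ⟨p, hx, hp⟩⟩
    | succ k ih =>
      have h1 := preimage_hesseStep_of_neg_three_lt (hfin ih.1) ih.2
      rw [ih.1] at h1
      have h2 := preimage_hesseStep_of_lt_neg_three (hfin h1.1) h1.2
      rw [h1.1, ← pow_succ] at h2
      exact h2
  refine ⟨heven.1, ?_⟩
  rw [hpre, (preimage_hesseStep_of_neg_three_lt (hfin heven.1) heven.2).1, heven.1]

theorem mainTheorem6 (r : ℕ) (hr : 1 ≤ r) :
    ((hesseChains ((-3 : ℝ) : OnePoint ℝ) (2 * r)).encard = 3 ^ (r - 1) ∧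
      (hesseChains ((-3 : ℝ) : OnePoint ℝ) (2 * r - 1)).encard = 3 ^ (r - 1)) ∧
    ((hesseChains OnePoint.infty (2 * r)).encard = 3 ^ (r - 1) ∧
      (hesseChains OnePoint.infty (2 * r - 1)).encard = 3 ^ (r - 1)) := by
  obtain ⟨k, rfl⟩ := Nat.exists_eq_add_of_le' hr
  have heven : 2 * (k + 1) = 2 * k + 1 + 1 := by ring
  have hodd : 2 * (k + 1) - 1 = 2 * k + 1 := by omega
  have h6 : ((6 : ℝ) : OnePoint ℝ) ≠ ((-3 : ℝ) : OnePoint ℝ) := by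
    rw [Ne, OnePoint.coe_eq_coe]
    norm_num
  rw [hodd, heven, Nat.add_sub_cancel, encard_hesseChains h6 hesseStep_eq_neg_three_iff,
    encard_hesseChains h6 hesseStep_eq_neg_three_iff,
    encard_hesseChains (OnePoint.coe_ne_infty 0) hesseStep_eq_infty_iff,
    encard_hesseChains (OnePoint.coe_ne_infty 0) hesseStep_eq_infty_iff]
  have h := encard_preimage_iterate_hesseStep (p := 6) (by norm_num) k
  have h' := encard_preimage_iterate_hesseStep (p := 0) (by norm_num) k
  -- With `r = k + 1`, lengths `2r` and `2r - 1` need `2k + 1` and `2k` backward steps from `p`.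
  exact ⟨⟨h.2, h.1⟩, ⟨h'.2, h'.1⟩⟩
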